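/- Let $M$ be a smooth $3$-manifold (Hausdorff, second countable, without boundary) and let $\alpha\in\Omega^1(M)$ be a smooth $1$-form. For a Riemannian metric $g$ and an orientation of $M$, let $\ast$ be the Hodge star operator. The form $\alpha$ is a *contact form* if $\alpha\wedge d\alpha$ is nowhere zero; it then induces an orientation of $M$, the one for which $\alpha\wedge d\alpha$ is positive. The form $\alpha$ is a *rotational Beltrami $1$-form* (for $g$ and the orientation) if $d\alpha=f\ast\alpha$ for some nowhere zero $f\in C^\infty(M)$. A metric $g$ is *adapted* to a contact form $\alpha$ if $d\alpha=2\ast\alpha$ and $g(\alpha^\sharp,\alpha^\sharp)=1$, where $\alpha^\sharp$ is the vector field dual to $\alpha$ and $\ast$ is taken with respect to $g$ and the orientation induced by $\alpha$. (i) If, for some orientation and some Riemannian metric on $M$, $\alpha$ is a rotational Beltrami $1$-form that is nowhere zero, then $\alpha$ is a contact form. (ii) Let $\alpha$ be a contact form and let $M$ carry the orientation induced by $\alpha$. Then $\alpha$ has an adapted Riemannian metric. Moreover, for every strictly positive $f\in C^\infty(M)$ and every metric $g$ adapted to $\alpha$, the Riemannian metric $\widetilde g=\frac{4}{f^2}\,g$,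 with Hodge star operator $\widetilde\ast$, satisfies $$d\alpha=f\,\widetilde\ast\,\alpha ,$$ so that $\alpha$ is a rotational Beltrami $1$-form for $\widetilde g$. If $M$ is non-empty, the Riemannian metrics that satisfy this equation, for given $\alpha$ and $f$, are not unique: there are at least two. -/

import Mathlib

open scoped Manifold ContDiff Topology
open Bundle

noncomputable section

namespace BeltramiContact

/-- The model space `ℝ³`. -/
abbrev E3 : Type := EuclideanSpace ℝ (Fin 3)

/-! ### Linear algebra in a three-dimensional real vector space -/

section Linear

variable {V : Type*} [AddCommGroup V] [Module ℝ V]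

/-- The wedge product `a ∧ β` of a linear form and an alternating bilinear form:
`(a ∧ β)(u, v, w) = a(u) β(v, w) - a(v) β(u, w) + a(w) β(u, v)`. -/
def wedge (a : V →ₗ[ℝ] ℝ) (β : V [⋀^Fin 2]→ₗ[ℝ] ℝ) : V [⋀^Fin 3]→ₗ[ℝ] ℝ :=
  AlternatingMap.alternatizeUncurryFin (a.smulRight β)

/-- The matrix `(g_{ij}) = (g(b_i, b_j))` of a bilinear form `g` in a basis `b`. -/
def gram (b : Module.Basis (Fin 3) ℝ V) (g : V → V → ℝ) : Matrix (Fin 3) (Fin 3) ℝ :=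
  Matrix.of fun i j => g (b i) (b j)

/-- The vector `a^♯ = ∑ g^{ij} a_i b_j`, where `(g^{ij})` is the inverse of `(g_{ij})` and
`a_i = a(b_i)`. -/
def sharpIn (b : Module.Basis (Fin 3) ℝ V) (g : V → V → ℝ) (a : V →ₗ[ℝ] ℝ) : V :=
  ∑ i, ∑ j, (a (b i) * (gram b g)⁻¹ i j) • b j

/-- The Hodge star `* : Λ¹ → Λ²` in a positively oriented basis `b`, with dual basis `b^i`:
`* a = √|g| ∑_{i,l} a_i g^{il} · (1/2) ∑_{j,k} ε_{ljk} b^j ∧ b^k`, where the form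
`(1/2) ∑_{j,k} ε_{ljk} b^j ∧ b^k` is `(v, w) ↦ det_b (b_l, v, w)`. -/
def hodgeIn (b : Module.Basis (Fin 3) ℝ V) (g : V → V → ℝ) (a : V →ₗ[ℝ] ℝ) :
    V [⋀^Fin 2]→ₗ[ℝ] ℝ :=
  Real.sqrt (gram b g).det •
    ∑ i, ∑ l, (a (b i) * (gram b g)⁻¹ i l) • b.det.curryLeft (b l)

end Linear

/-! ### Forms, metrics and orientations on a smooth 3-manifold without boundary -/

section Manifold

variable (M : Type*) [TopologicalSpace M] [ChartedSpace E3 M] [IsManifold (𝓡 3) ∞ M]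

/-- Smooth 1-forms: smooth sections of the cotangent bundle. -/
abbrev OneForm : Type _ :=
  ContMDiffSection (𝓡 3) (E3 →L[ℝ] ℝ) ∞ (fun x : M => TangentSpace (𝓡 3) x →L[ℝ] ℝ)

/-- Smooth Riemannian metrics. -/
abbrev Metric3 : Type _ :=
  ContMDiffRiemannianMetric (𝓡 3) ∞ E3 (fun x : M => TangentSpace (𝓡 3) x)

/-- The derivative at `x` of the chart at `x₀`. -/
def chartDeriv {M : Type*} [TopologicalSpace M] [ChartedSpace E3 M] (x₀ x : M) :
    TangentSpace (𝓡 3) x →L[ℝ] E3 :=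
  mfderiv (𝓡 3) 𝓘(ℝ, E3) (extChartAt (𝓡 3) x₀) x

/-- The derivative at `u` of the inverse of the chart at `x₀`. -/
def chartSymmDeriv {M : Type*} [TopologicalSpace M] [ChartedSpace E3 M] (x₀ : M) (u : E3) :
    E3 →L[ℝ] TangentSpace (𝓡 3) ((extChartAt (𝓡 3) x₀).symm u) :=
  mfderiv 𝓘(ℝ, E3) (𝓡 3) (extChartAt (𝓡 3) x₀).symm u

/-- An orientation of a 3-manifold: an orientation of every tangent space which, near every
point `x₀`, is given by one fixed constant-coefficient volume form in the chart at `x₀`. -/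
structure ManifoldOrientation where
  /-- the orientation of the tangent space at `x` -/
  at' (x : M) : Orientation ℝ (TangentSpace (𝓡 3) x) (Fin 3)
  coherent (x₀ : M) : ∃ η : E3 [⋀^Fin 3]→ₗ[ℝ] ℝ, ∀ᶠ x in 𝓝 x₀,
    ∃ h : η.compLinearMap (chartDeriv x₀ x).toLinearMap ≠ 0,
      at' x = rayOfNeZero ℝ _ h

variable {M}

/-- The basis of coordinate vectors at `x` in the preferred chart at `x`. -/
def coordBasis (x : M) : Module.Basis (Fin 3) ℝ (TangentSpace (𝓡 3) x) :=
  (EuclideanSpace.basisFun (Fin 3) ℝ).toBasis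

/-- The coordinate expression, on the target of the chart at `x₀`, of a 1-form: its pullback
under the inverse of the chart. -/
def localForm (α : OneForm M) (x₀ : M) (u : E3) : E3 →L[ℝ] ℝ :=
  (α ((extChartAt (𝓡 3) x₀).symm u)).comp (chartSymmDeriv x₀ u)

/-- The exterior derivative `dα` at `x`: the exterior derivative of the coordinate expression
of `α` in the chart at `x`, pulled back by the chart. -/
def dForm (α : OneForm M) (x : M) : TangentSpace (𝓡 3) x [⋀^Fin 2]→ₗ[ℝ] ℝ :=
  (extDeriv (fun u => ContinuousAlternatingMap.ofSubsingleton ℝ E3 ℝ (0 : Fin 1)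
      (localForm α x u)) (extChartAt (𝓡 3) x x)).toAlternatingMap.compLinearMap
    (chartDeriv x x).toLinearMap

/-- The 3-form `α ∧ dα`. -/
def wedgeD (α : OneForm M) (x : M) : TangentSpace (𝓡 3) x [⋀^Fin 3]→ₗ[ℝ] ℝ :=
  wedge (α x).toLinearMap (dForm α x)

/-- A contact form: `α ∧ dα` is nowhere zero. -/
def IsContactForm (α : OneForm M) : Prop := ∀ x, wedgeD α x ≠ 0

/-- `o` is the orientation induced by the contact form `α`, that is, the one for which `α ∧ dα`
is a positive volume form. -/
def IsInducedOrientation (o : ManifoldOrientation M) (α : OneForm M) : Prop :=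
  ∀ x, ∃ h : wedgeD α x ≠ 0, o.at' x = rayOfNeZero ℝ _ h

/-- The vector field `α^♯` metrically dual to `α`. -/
def sharp (g : Metric3 M) (α : OneForm M) (x : M) : TangentSpace (𝓡 3) x :=
  sharpIn (coordBasis x) (fun v w => g.inner x v w) (α x).toLinearMap

/-- The Hodge star `*α` of a 1-form, for the metric `g` and the orientation `o`; it is computed
in the coordinate basis, with one vector negated if that basis is negatively oriented. -/
def hodge (o : ManifoldOrientation M) (g : Metric3 M) (α : OneForm M) (x : M) :
    TangentSpace (𝓡 3) x [⋀^Fin 2]→ₗ[ℝ] ℝ :=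
  hodgeIn ((coordBasis x).adjustToOrientation (o.at' x)) (fun v w => g.inner x v w)
    (α x).toLinearMap

/-- The equation `dα = f * α`. -/
def BeltramiEq (o : ManifoldOrientation M) (g : Metric3 M) (f : C^∞⟮𝓡 3, M; ℝ⟯)
    (α : OneForm M) : Prop :=
  ∀ x, dForm α x = f x • hodge o g α x

/-- `α` is a rotational Beltrami 1-form: `dα = f * α` for some nowhere zero smooth function
`f`. -/
def IsRotationalBeltrami (o : ManifoldOrientation M) (g : Metric3 M) (α : OneForm M) : Prop :=
  ∃ f : C^∞⟮𝓡 3, M; ℝ⟯, (∀ x, f x ≠ 0) ∧ BeltramiEq o g f α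

/-- The contact form `α` and the metric `g` are adapted: `dα = 2 * α` and `g(α^♯, α^♯) = 1`. -/
def IsAdapted (o : ManifoldOrientation M) (g : Metric3 M) (α : OneForm M) : Prop :=
  IsContactForm α ∧ ∀ x, dForm α x = (2 : ℝ) • hodge o g α x ∧
    g.inner x (sharp g α x) (sharp g α x) = 1

/-- `g' = μ g` for the function `μ`. -/
def IsRescaling (μ : M → ℝ) (g g' : Metric3 M) : Prop :=
  ∀ (x : M) (v w : TangentSpace (𝓡 3) x), g'.inner x v w = μ x * g.inner x v w

end Manifold

end BeltramiContact

end

open BeltramiContact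

noncomputable section

namespace BeltramiContact

/-! ### Forms, Gram matrices and the Hodge star on a three-dimensional vector space. -/

section LinearAlgebra

variable {V : Type*} [AddCommGroup V] [Module ℝ V]

/-! For (i), `a ∧ *a` is `|a|²` times the Riemannian volume form, so `dα = f * α` with `f` and `α`
nowhere zero forces `α ∧ dα ≠ 0` (`wedge_ne_zero_of_eq_smul_hodgeIn`).

For (ii), the Reeb vector `R` is given by `α(R) = 1` and `ι_R dα = 0`, so that `dα = ι_R (α ∧ dα)`.
If `g(R, ·) = p α`, then `α^♯ = R / p` and `*α = ι_R vol / p`. Hence `dα = c * α` reduces to one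
scalar equation, `c vol = p α ∧ dα` (`eq_smul_hodgeIn`).

Metrics with `g(R, ·) = α` form a convex set at each point, so a partition of unity yields a global
one (`exists_reeb_metric`). Replacing it by `p α⊗α + q (g - α⊗α)` keeps `R` normal to the contact
planes and multiplies the volume by `√p q` (`gram_combine_det`). With `p = 1`, a suitable `q` gives
an adapted metric. Starting from an adapted metric, the Beltrami equation for `f` becomes `f q = 2
√p`: one equation for two functions. The choice `p = q` gives `4 / f²`; any other `p` shows
non-uniqueness. -/

theorem wedge_apply (a : V →ₗ[ℝ] ℝ) (β : V [⋀^Fin 2]→ₗ[ℝ] ℝ) (v : Fin 3 → V) :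
    wedge a β v = a (v 0) * β ![v 1, v 2] - a (v 1) * β ![v 0, v 2] + a (v 2) * β ![v 0, v 1] := by
  have h0 : (0 : Fin 3).removeNth v = ![v 1, v 2] := by
    ext i; fin_cases i <;> rfl
  have h1 : (1 : Fin 3).removeNth v = ![v 0, v 2] := by
    ext i; fin_cases i <;> rfl
  have h2 : (2 : Fin 3).removeNth v = ![v 0, v 1] := by
    ext i; fin_cases i <;> rfl
  simp [wedge, AlternatingMap.alternatizeUncurryFin_apply, Fin.sum_univ_three, h0, h1, h2]
  ring

theorem wedge_smul_right (a : V →ₗ[ℝ] ℝ) (c : ℝ) (β : V [⋀^Fin 2]→ₗ[ℝ] ℝ) :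
    wedge a (c • β) = c • wedge a β := by
  ext v
  simp only [wedge_apply, AlternatingMap.smul_apply, smul_eq_mul]
  ring

theorem map_pair_swap (β : V [⋀^Fin 2]→ₗ[ℝ] ℝ) (v w : V) : β ![v, w] = - β ![w, v] := by
  have h := β.map_swap ![w, v] (i := 0) (j := 1) (by decide)
  rw [← h]
  congr 1
  ext i; fin_cases i <;> rfl

theorem map_pair_self (β : V [⋀^Fin 2]→ₗ[ℝ] ℝ) (v : V) : β ![v, v] = 0 :=
  β.map_eq_zero_of_eq ![v, v] (i := 0) (j := 1) rfl (by decide)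

/-- The bilinear map underlying an alternating bilinear form. -/
def alternatingBilin (β : V [⋀^Fin 2]→ₗ[ℝ] ℝ) : V →ₗ[ℝ] V →ₗ[ℝ] ℝ :=
  LinearMap.mk₂ ℝ (fun v w => β ![v, w])
    (fun v v' w => β.map_vecCons_add ![w] v v')
    (fun c v w => β.map_vecCons_smul ![w] c v)
    (fun v w w' => by
      rw [map_pair_swap, map_pair_swap β v w, map_pair_swap β v w']
      rw [β.map_vecCons_add ![v] w w']; ring)
    (fun c v w => by
      rw [map_pair_swap, map_pair_swap β v w]
      rw [β.map_vecCons_smul ![v] c w]; simp)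

@[simp]
theorem alternatingBilin_apply (β : V [⋀^Fin 2]→ₗ[ℝ] ℝ) (v w : V) :
    alternatingBilin β v w = β ![v, w] := rfl

theorem alternating_two_ext {β γ : V [⋀^Fin 2]→ₗ[ℝ] ℝ}
    (h : ∀ v w, β ![v, w] = γ ![v, w]) : β = γ := by
  ext v
  have hv : v = ![v 0, v 1] := by ext i; fin_cases i <;> rfl
  rw [hv, h]

/-- If `ι_R β = 0` and `a(R) = 1`, then `ι_R (a ∧ β) = β`. -/
theorem curryLeft_wedge {a : V →ₗ[ℝ] ℝ} {β : V [⋀^Fin 2]→ₗ[ℝ] ℝ} {R : V} (haR : a R = 1)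
    (hR : ∀ v, β ![R, v] = 0) : (wedge a β).curryLeft R = β := by
  refine alternating_two_ext fun v w => ?_
  rw [AlternatingMap.curryLeft_apply_apply, wedge_apply]
  simp [haR, hR]

/-- If `a ∧ β ≠ 0`, the kernel of `β` contains a vector `R` with `a(R) = 1`. -/
theorem exists_reeb_of_wedge_ne_zero (b : Module.Basis (Fin 3) ℝ V) {a : V →ₗ[ℝ] ℝ}
    {β : V [⋀^Fin 2]→ₗ[ℝ] ℝ} (h : wedge a β ≠ 0) :
    ∃ R : V, a R = 1 ∧ ∀ v, β ![R, v] = 0 := by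
  have hb : wedge a β b ≠ 0 := by
    intro h0
    apply h
    rw [AlternatingMap.eq_smul_basis_det b (wedge a β), h0, zero_smul]
  -- `N` is the cross-product vector of `β`: it spans the kernel that an alternating form has in
  -- dimension three, and `a(N)` is the value of `a ∧ β` on the basis.
  set N : V := β ![b 1, b 2] • b 0 - β ![b 0, b 2] • b 1 + β ![b 0, b 1] • b 2 with hN
  have haN : a N = wedge a β b := by
    rw [wedge_apply, hN]
    simp only [map_add, map_sub, map_smul, smul_eq_mul]
    ring
  have hβN : alternatingBilin β N = 0 := by
    refine b.ext fun k => ?_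
    rw [hN]
    simp only [map_add, map_sub, map_smul, LinearMap.add_apply, LinearMap.sub_apply,
      LinearMap.smul_apply, alternatingBilin_apply, smul_eq_mul, LinearMap.zero_apply]
    fin_cases k
    · simp only [Fin.zero_eta, map_pair_self, map_pair_swap β (b 1) (b 0),
        map_pair_swap β (b 2) (b 0)]
      ring
    · simp only [Fin.mk_one, map_pair_self, map_pair_swap β (b 2) (b 1)]
      ring
    · simp only [Fin.reduceFinMk, map_pair_self]
      ring
  refine ⟨(wedge a β b)⁻¹ • N, ?_, fun v => ?_⟩
  · rw [map_smul, haN, smul_eq_mul, inv_mul_cancel₀ hb]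
  · rw [← alternatingBilin_apply, map_smul, hβN]
    simp

/-- The four-form `a ∧ det_b` is zero in dimension three; contracting it with `s` gives `a ∧ ι_s
det_b = a(s) det_b`. -/
theorem wedge_curryLeft_det (b : Module.Basis (Fin 3) ℝ V) (a : V →ₗ[ℝ] ℝ) (s : V) :
    wedge a (b.det.curryLeft s) b = a s := by
  have h (v w : Fin 3) : (b.det.curryLeft s) ![b v, b w] = b.det ![s, b v, b w] := rfl
  rw [wedge_apply, h, h, h]
  simp only [Module.Basis.det_apply, Matrix.det_fin_three, Module.Basis.toMatrix_apply]
  simp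
  conv_rhs => rw [← b.sum_repr s, Fin.sum_univ_three]
  simp only [map_add, map_smul, smul_eq_mul]
  ring

/-- A vector in both kernels annihilates the volume form `a ∧ β`, hence also `det_b`; the previous
identity, applied to the coordinate forms, then makes its coordinates vanish. This gives
definiteness of the local metrics built from `α` and `dα`. -/
theorem eq_zero_of_wedge_ne_zero (b : Module.Basis (Fin 3) ℝ V) {a : V →ₗ[ℝ] ℝ}
    {β : V [⋀^Fin 2]→ₗ[ℝ] ℝ} (h : wedge a β ≠ 0) {v : V} (hav : a v = 0)
    (hβv : ∀ w, β ![v, w] = 0) : v = 0 := by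
  have hb : wedge a β b ≠ 0 := by
    intro h0
    apply h
    rw [AlternatingMap.eq_smul_basis_det b (wedge a β), h0, zero_smul]
  have h1 : b.det.curryLeft v = 0 := by
    refine alternating_two_ext fun u w => ?_
    have h2 : wedge a β ![v, u, w] = 0 := by
      rw [wedge_apply]
      simp [hav, hβv]
    rw [AlternatingMap.eq_smul_basis_det b (wedge a β), AlternatingMap.smul_apply,
      smul_eq_mul] at h2
    exact (mul_eq_zero.1 h2).resolve_left hb
  refine b.ext_elem fun i => ?_
  have h3 := wedge_curryLeft_det b (b.coord i) v
  rw [h1] at h3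
  rw [map_zero, Finsupp.zero_apply, ← b.coord_apply, ← h3, wedge_apply]
  simp

section Metric

variable (b : Module.Basis (Fin 3) ℝ V) (B : V →ₗ[ℝ] V →ₗ[ℝ] ℝ)

theorem gram_det_pos (hs : ∀ v w, B v w = B w v) (hp : ∀ v, v ≠ 0 → 0 < B v v) :
    0 < (gram b fun v w => B v w).det := by
  refine Matrix.PosDef.det_pos ?_
  refine Matrix.PosDef.of_dotProduct_mulVec_pos ?_ fun x hx => ?_
  · ext i j
    simp [gram, hs (b j) (b i)]
  · have hv : ∑ i, x i • b i ≠ 0 := by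
      intro h0
      exact hx (funext fun i => Fintype.linearIndependent_iff.1 b.linearIndependent x h0 i)
    have := hp _ hv
    simp only [map_sum, map_smul, LinearMap.sum_apply, LinearMap.smul_apply, smul_eq_mul] at this
    refine this.trans_eq ?_
    simp only [dotProduct, Matrix.mulVec, gram, Matrix.of_apply, Pi.star_apply, star_trivial,
      Finset.mul_sum]
    exact Finset.sum_comm.trans (Finset.sum_congr rfl fun i _ => Finset.sum_congr rfl fun j _ => by ring)

theorem apply_sharpIn (hs : ∀ v w, B v w = B w v) (hp : ∀ v, v ≠ 0 → 0 < B v v)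
    (a : V →ₗ[ℝ] ℝ) (v : V) : B (sharpIn b (fun v w => B v w) a) v = a v := by
  have hG : IsUnit (gram b fun v w => B v w).det := (gram_det_pos b B hs hp).ne'.isUnit
  suffices h : B (sharpIn b (fun v w => B v w) a) = a by rw [h]
  refine b.ext fun k => ?_
  have h1 := Matrix.nonsing_inv_mul _ hG
  simp only [sharpIn, map_sum, map_smul, LinearMap.sum_apply, LinearMap.smul_apply, smul_eq_mul]
  have h2 (i : Fin 3) : ∑ j, a (b i) * (gram b fun v w => B v w)⁻¹ i j * B (b j) (b k)
      = a (b i) * (1 : Matrix (Fin 3) (Fin 3) ℝ) i k := by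
    rw [← h1, Matrix.mul_apply, Finset.mul_sum]
    exact Finset.sum_congr rfl fun j _ => by simp [gram, mul_assoc]
  simp_rw [h2]
  simp [Matrix.one_apply]

theorem sharpIn_eq (hs : ∀ v w, B v w = B w v) (hp : ∀ v, v ≠ 0 → 0 < B v v)
    {a : V →ₗ[ℝ] ℝ} {s : V} (h : ∀ v, B s v = a v) : sharpIn b (fun v w => B v w) a = s := by
  by_contra hne
  have := hp _ (sub_ne_zero.2 hne)
  refine this.ne ?_
  rw [map_sub B, LinearMap.sub_apply, apply_sharpIn b B hs hp, h, sub_self]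

theorem hodgeIn_eq (a : V →ₗ[ℝ] ℝ) :
    hodgeIn b (fun v w => B v w) a =
      √(gram b fun v w => B v w).det • b.det.curryLeft (sharpIn b (fun v w => B v w) a) := by
  simp only [hodgeIn, sharpIn, map_sum, map_smul]

/-- `a ∧ *a = √|g| |a|²` in the volume form of the basis. -/
theorem wedge_hodgeIn (a : V →ₗ[ℝ] ℝ) :
    wedge a (hodgeIn b (fun v w => B v w) a) b =
      √(gram b fun v w => B v w).det * a (sharpIn b (fun v w => B v w) a) := by
  rw [hodgeIn_eq, wedge_smul_right, AlternatingMap.smul_apply, wedge_curryLeft_det, smul_eq_mul]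

variable {b B}

theorem wedge_ne_zero_of_eq_smul_hodgeIn (hs : ∀ v w, B v w = B w v)
    (hp : ∀ v, v ≠ 0 → 0 < B v v) {a : V →ₗ[ℝ] ℝ} (ha : a ≠ 0) {c : ℝ} (hc : c ≠ 0)
    {β : V [⋀^Fin 2]→ₗ[ℝ] ℝ} (hβ : β = c • hodgeIn b (fun v w => B v w) a) : wedge a β ≠ 0 := by
  intro h0
  have h1 : wedge a β b = 0 := by rw [h0]; rfl
  set s := sharpIn b (fun v w => B v w) a with hsdef
  have hsv : ∀ v, B s v = a v := apply_sharpIn b B hs hp a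
  have hs0 : s ≠ 0 := by
    intro h
    apply ha
    ext v
    rw [← hsv, h]
    simp
  rw [hβ, wedge_smul_right, AlternatingMap.smul_apply, wedge_hodgeIn, ← hsdef, ← hsv,
    smul_eq_mul] at h1
  exact mul_ne_zero hc (mul_ne_zero (Real.sqrt_pos.2 (gram_det_pos b B hs hp)).ne' (hp s hs0).ne') h1

/-- A metric for which `R` is normal to `ker a` and whose volume form is the right multiple of
`a ∧ β` satisfies `β = c * a`. -/
theorem eq_smul_hodgeIn (hs : ∀ v w, B v w = B w v) (hp : ∀ v, v ≠ 0 → 0 < B v v)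
    {a : V →ₗ[ℝ] ℝ} {β : V [⋀^Fin 2]→ₗ[ℝ] ℝ} {R : V} (haR : a R = 1) (hR : ∀ v, β ![R, v] = 0)
    {c p : ℝ} (hp0 : p ≠ 0) (hBR : ∀ v, B R v = p * a v)
    (hvol : c * √(gram b fun v w => B v w).det = p * wedge a β b) :
    β = c • hodgeIn b (fun v w => B v w) a := by
  have hsharp : sharpIn b (fun v w => B v w) a = p⁻¹ • R := by
    refine sharpIn_eq b B hs hp fun v => ?_
    rw [map_smul, LinearMap.smul_apply, hBR, smul_eq_mul, inv_mul_cancel_left₀ hp0]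
  rw [hodgeIn_eq, hsharp, map_smul, smul_smul, smul_smul, hvol, mul_comm p, mul_assoc,
    mul_inv_cancel₀ hp0, mul_one]
  -- Both sides are multiples of `ι_R det_b`, since `β = ι_R (a ∧ β)` and `a ∧ β` is a multiple of
  -- `det_b`.
  conv_lhs => rw [← curryLeft_wedge haR hR, AlternatingMap.eq_smul_basis_det b (wedge a β)]
  rfl

/-- The consequences of `β = c * a` for a unit form `a`. -/
theorem reeb_of_eq_smul_hodgeIn (hs : ∀ v w, B v w = B w v) (hp : ∀ v, v ≠ 0 → 0 < B v v)
    {a : V →ₗ[ℝ] ℝ} {β : V [⋀^Fin 2]→ₗ[ℝ] ℝ} {R : V} (hBR : ∀ v, B R v = a v) (haR : a R = 1)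
    {c : ℝ} (hβ : β = c • hodgeIn b (fun v w => B v w) a) :
    (∀ v, β ![R, v] = 0) ∧ c * √(gram b fun v w => B v w).det = wedge a β b := by
  have hsharp : sharpIn b (fun v w => B v w) a = R := sharpIn_eq b B hs hp hBR
  constructor
  · intro v
    have : b.det ![R, R, v] = 0 :=
      b.det.map_eq_zero_of_eq ![R, R, v] (i := 0) (j := 1) rfl (by decide)
    rw [hβ, hodgeIn_eq, hsharp]
    simp only [AlternatingMap.smul_apply, AlternatingMap.curryLeft_apply_apply]
    simp [this]
  · rw [hβ, wedge_smul_right, AlternatingMap.smul_apply, wedge_hodgeIn, hsharp, haR]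
    simp

variable (b)

theorem gram_family_det (v : Fin 3 → V) :
    (Matrix.of fun i j => B (v i) (v j)).det = b.det v ^ 2 * (gram b fun v w => B v w).det := by
  have h : (Matrix.of fun i j => B (v i) (v j)) =
      (b.toMatrix v).transpose * (gram b fun v w => B v w) * b.toMatrix v := by
    ext i j
    have hv (k : Fin 3) : v k = ∑ l, b.repr (v k) l • b l := (b.sum_repr (v k)).symm
    rw [Matrix.of_apply, hv i, hv j]
    simp only [map_sum, map_smul, LinearMap.sum_apply, LinearMap.smul_apply, smul_eq_mul,
      Matrix.mul_apply, Matrix.transpose_apply, Module.Basis.toMatrix_apply, gram, Matrix.of_apply,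
      Finset.mul_sum, Finset.sum_mul]
    exact Finset.sum_congr rfl fun k _ => Finset.sum_congr rfl fun l _ => by ring
  rw [h, Matrix.det_mul, Matrix.det_mul, Matrix.det_transpose, Module.Basis.det_apply]
  ring

theorem alternating_family_apply (η : V [⋀^Fin 3]→ₗ[ℝ] ℝ) (v : Fin 3 → V) :
    η v = b.det v * η b := by
  conv_lhs => rw [AlternatingMap.eq_smul_basis_det b η]
  simp [mul_comm]

/-- The Gram determinant of `p a⊗a + q (B - a⊗a)`, where `a` has unit length for `B`. -/
theorem gram_combine_det {a : V →ₗ[ℝ] ℝ} {R : V} (hBR : ∀ v, B R v = a v) (haR : a R = 1)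
    (hs : ∀ v w, B v w = B w v) (p q : ℝ) :
    (gram b fun v w => p * (a v * a w) + q * (B v w - a v * a w)).det =
      p * q ^ 2 * (gram b fun v w => B v w).det := by
  have hker (k : Fin 3) : ∑ l, (B (b k) (b l) - a (b k) * a (b l)) * b.repr R l = 0 := by
    have h1 : ∑ l, b.repr R l * B (b k) (b l) = B (b k) R := by
      conv_rhs => rw [← b.sum_repr R]
      simp only [map_sum, map_smul, smul_eq_mul]
    have h2 : ∑ l, b.repr R l * a (b l) = a R := by
      conv_rhs => rw [← b.sum_repr R]
      simp only [map_sum, map_smul, smul_eq_mul]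
    calc _ = ∑ l, (b.repr R l * B (b k) (b l) - a (b k) * (b.repr R l * a (b l))) :=
          Finset.sum_congr rfl fun l _ => by ring
      _ = 0 := by rw [Finset.sum_sub_distrib, ← Finset.mul_sum, h1, h2, haR, hs, hBR]; ring
  have hR0 : (fun l => b.repr R l) ≠ 0 := by
    intro h
    have : R = 0 := b.repr.map_eq_zero_iff.1 (Finsupp.ext fun l => congrFun h l)
    rw [this, map_zero] at haR
    exact zero_ne_one haR
  have hdet : (Matrix.of fun i j => B (b i) (b j) - a (b i) * a (b j)).det = 0 :=
    Matrix.exists_mulVec_eq_zero_iff.1 ⟨_, hR0, funext fun k => hker k⟩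
  rw [Matrix.det_fin_three] at hdet
  simp only [gram, Matrix.det_fin_three, Matrix.of_apply] at hdet ⊢
  -- With `H = G - a aᵀ`, the rank-one update gives `det (q H + p a aᵀ) = q³ det H + p q² aᵀ adj(H)
  -- a` and `det G = det H + aᵀ adj(H) a`. Here `det H = 0` because `H` kills `R`.
  linear_combination (q ^ 3 - p * q ^ 2) * hdet

end Metric

end LinearAlgebra

/-! ### Coordinate frames, smoothness criteria, and chart independence of `dα`. -/

section Charts

variable {M : Type*} [TopologicalSpace M] [ChartedSpace E3 M] [IsManifold (𝓡 3) ∞ M]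

/-- The coordinate frame of the preferred chart at `x₀`, as a linear map from `ℝ³` to the tangent
space at `x`. -/
def frame (x₀ x : M) : E3 →L[ℝ] TangentSpace (𝓡 3) x :=
  (trivializationAt E3 (TangentSpace (𝓡 3)) x₀).symmL ℝ x

theorem chartDeriv_eq {x₀ x : M} (hx : x ∈ (chartAt E3 x₀).source) :
    chartDeriv x₀ x = (trivializationAt E3 (TangentSpace (𝓡 3)) x₀).continuousLinearMapAt ℝ x :=
  (TangentBundle.continuousLinearMapAt_trivializationAt hx).symm

theorem chartDeriv_frame {x₀ x : M} (hx : x ∈ (chartAt E3 x₀).source) (v : E3) :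
    chartDeriv x₀ x (frame x₀ x v) = v := by
  rw [chartDeriv_eq hx]
  exact Trivialization.continuousLinearMapAt_symmL _ hx v

theorem frame_chartDeriv {x₀ x : M} (hx : x ∈ (chartAt E3 x₀).source) (v : TangentSpace (𝓡 3) x) :
    frame x₀ x (chartDeriv x₀ x v) = v := by
  rw [chartDeriv_eq hx]
  exact Trivialization.symmL_continuousLinearMapAt _ hx v

/-- A one-form in the coordinate frame at `x₀`, as a function on the manifold. -/
def frameForm (α : OneForm M) (x₀ x : M) : E3 →L[ℝ] ℝ := (α x).comp (frame x₀ x)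

/-- On the chart target, the derivative of the inverse chart is the inverse of the bundle
trivialization; this lets smoothness of sections pass to coordinate expressions. -/
theorem localForm_eq (α : OneForm M) (x₀ : M) {u : E3} (hu : u ∈ (extChartAt (𝓡 3) x₀).target) :
    localForm α x₀ u = frameForm α x₀ ((extChartAt (𝓡 3) x₀).symm u) := by
  have hx : (extChartAt (𝓡 3) x₀).symm u ∈ (chartAt E3 x₀).source := by
    simpa using (extChartAt (𝓡 3) x₀).map_target hu
  have h := TangentBundle.symmL_trivializationAt (I := 𝓡 3) hx
  have hu' : extChartAt (𝓡 3) x₀ ((extChartAt (𝓡 3) x₀).symm u) = u :=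
    (extChartAt (𝓡 3) x₀).right_inv hu
  rw [localForm, frameForm]
  congr 1
  rw [frame, h, chartSymmDeriv, ← mfderivWithin_univ, ModelWithCorners.range_eq_univ]
  ext v
  rw! [hu']
  rfl

theorem contMDiffAt_frame (x₀ : M) {x : M} (hx : x ∈ (chartAt E3 x₀).source) (v : E3) :
    ContMDiffAt (𝓡 3) ((𝓡 3).prod 𝓘(ℝ, E3)) ∞
      (fun y => TotalSpace.mk' E3 (E := fun x : M => TangentSpace (𝓡 3) x) y (frame x₀ y v)) x := by
  rw [Trivialization.contMDiffAt_section_iff (trivializationAt E3 (TangentSpace (𝓡 3)) x₀) hx]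
  refine (contMDiffAt_const (c := v)).congr_of_eventuallyEq ?_
  filter_upwards [(trivializationAt E3 (TangentSpace (𝓡 3)) x₀).open_baseSet.mem_nhds hx]
    with y hy
  have h := Trivialization.continuousLinearMapAt_symmL (R := ℝ) _ hy v
  rwa [Trivialization.continuousLinearMapAt_apply, Trivialization.coe_linearMapAt_of_mem _ hy] at h

omit [IsManifold (𝓡 3) ∞ M] in
/-- A function into a space of linear maps is smooth if its values on vectors are. -/
theorem contMDiffAt_clm_of_apply {G : Type*} [NormedAddCommGroup G] [NormedSpace ℝ G]
    {L : M → E3 →L[ℝ] G} {x : M}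
    (hL : ∀ v, ContMDiffAt (𝓡 3) 𝓘(ℝ, G) ∞ (fun y => L y v) x) :
    ContMDiffAt (𝓡 3) 𝓘(ℝ, E3 →L[ℝ] G) ∞ L x := by
  have h (y : M) : L y = ∑ i, ContinuousLinearMap.smulRightL ℝ E3 G
      (EuclideanSpace.proj i) (L y (EuclideanSpace.single i 1)) := by
    ext v
    conv_lhs => rw [← (EuclideanSpace.basisFun (Fin 3) ℝ).sum_repr v]
    simp
  rw [funext h]
  exact ContMDiffAt.sum fun i _ =>
    (ContinuousLinearMap.smulRightL ℝ E3 G _).contMDiff.contMDiffAt.comp x (hL _)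

theorem contMDiffAt_oneForm_apply (α : OneForm M) {X : ∀ x : M, TangentSpace (𝓡 3) x} {x : M}
    (hX : ContMDiffAt (𝓡 3) ((𝓡 3).prod 𝓘(ℝ, E3)) ∞
      (fun y => TotalSpace.mk' E3 (E := fun x : M => TangentSpace (𝓡 3) x) y (X y)) x) :
    ContMDiffAt (𝓡 3) 𝓘(ℝ) ∞ (fun y => α y (X y)) x := by
  have h : ContMDiffAt (𝓡 3) ((𝓡 3).prod 𝓘(ℝ)) ∞
      (fun m ↦ TotalSpace.mk' ℝ (E := Bundle.Trivial M ℝ) m (α m (X m))) x :=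
    ContMDiffAt.clm_bundle_apply (F₁ := E3) (F₂ := ℝ) (E₁ := fun x : M => TangentSpace (𝓡 3) x)
      (α.contMDiff x) hX
  exact (contMDiffAt_totalSpace.1 h).2

/-- A bilinear form on the tangent bundle applied to smooth vector fields is smooth. -/
theorem contMDiffAt_bilin_apply {B : ∀ x : M, TangentSpace (𝓡 3) x →L[ℝ] TangentSpace (𝓡 3) x →L[ℝ] ℝ}
    {X Y : ∀ x : M, TangentSpace (𝓡 3) x} {x : M}
    (hB : ContMDiffAt (𝓡 3) ((𝓡 3).prod 𝓘(ℝ, E3 →L[ℝ] E3 →L[ℝ] ℝ)) ∞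
      (fun y => TotalSpace.mk' (E3 →L[ℝ] E3 →L[ℝ] ℝ)
        (E := fun x : M => TangentSpace (𝓡 3) x →L[ℝ] TangentSpace (𝓡 3) x →L[ℝ] ℝ) y (B y)) x)
    (hX : ContMDiffAt (𝓡 3) ((𝓡 3).prod 𝓘(ℝ, E3)) ∞
      (fun y => TotalSpace.mk' E3 (E := fun x : M => TangentSpace (𝓡 3) x) y (X y)) x)
    (hY : ContMDiffAt (𝓡 3) ((𝓡 3).prod 𝓘(ℝ, E3)) ∞
      (fun y => TotalSpace.mk' E3 (E := fun x : M => TangentSpace (𝓡 3) x) y (Y y)) x) :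
    ContMDiffAt (𝓡 3) 𝓘(ℝ) ∞ (fun y => B y (X y) (Y y)) x := by
  have h : ContMDiffAt (𝓡 3) ((𝓡 3).prod 𝓘(ℝ)) ∞
      (fun m ↦ TotalSpace.mk' ℝ (E := Bundle.Trivial M ℝ) m (B m (X m) (Y m))) x :=
    ContMDiffAt.clm_bundle_apply₂ (F₁ := E3) (F₂ := E3) (F₃ := ℝ)
      (E₁ := fun x : M => TangentSpace (𝓡 3) x) (E₂ := fun x : M => TangentSpace (𝓡 3) x) hB hX hY
  exact (contMDiffAt_totalSpace.1 h).2

/-- A bilinear form on the tangent bundle is smooth at `x` if its coefficients in the coordinate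
frame at `x` are. -/
theorem contMDiffAt_bilin_of_frame
    {B : ∀ x : M, TangentSpace (𝓡 3) x →L[ℝ] TangentSpace (𝓡 3) x →L[ℝ] ℝ} {x : M}
    (hB : ∀ v w : E3, ContMDiffAt (𝓡 3) 𝓘(ℝ) ∞ (fun y => B y (frame x y v) (frame x y w)) x) :
    ContMDiffAt (𝓡 3) ((𝓡 3).prod 𝓘(ℝ, E3 →L[ℝ] E3 →L[ℝ] ℝ)) ∞
      (fun y => TotalSpace.mk' (E3 →L[ℝ] E3 →L[ℝ] ℝ)
        (E := fun x : M => TangentSpace (𝓡 3) x →L[ℝ] TangentSpace (𝓡 3) x →L[ℝ] ℝ) y (B y)) x := by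
  rw [contMDiffAt_hom_bundle]
  refine ⟨contMDiffAt_id, contMDiffAt_clm_of_apply fun v => contMDiffAt_clm_of_apply fun w => ?_⟩
  refine (hB v w).congr_of_eventuallyEq ?_
  filter_upwards [(chartAt E3 x).open_source.mem_nhds (mem_chart_source E3 x)] with y hy
  rw [inCoordinates_apply_eq₂ hy hy (by trivial)]
  rw [← Trivialization.symmL_apply (R := ℝ) _ hy, ← Trivialization.symmL_apply (R := ℝ) _ hy]
  simp [frame, -Trivialization.symmL_apply]

theorem contMDiffAt_frameForm (α : OneForm M) (x₀ : M) {x : M}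
    (hx : x ∈ (chartAt E3 x₀).source) :
    ContMDiffAt (𝓡 3) 𝓘(ℝ, E3 →L[ℝ] ℝ) ∞ (frameForm α x₀) x := by
  refine contMDiffAt_clm_of_apply fun v => ?_
  exact contMDiffAt_oneForm_apply α (contMDiffAt_frame x₀ hx v)

theorem contDiffAt_localForm (α : OneForm M) (x₀ : M) {u : E3}
    (hu : u ∈ (extChartAt (𝓡 3) x₀).target) : ContDiffAt ℝ ∞ (localForm α x₀) u := by
  have hx : (extChartAt (𝓡 3) x₀).symm u ∈ (chartAt E3 x₀).source := by
    simpa using (extChartAt (𝓡 3) x₀).map_target hu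
  have h1 : ContMDiffAt 𝓘(ℝ, E3) (𝓡 3) ∞ (extChartAt (𝓡 3) x₀).symm u :=
    (contMDiffOn_extChartAt_symm x₀).contMDiffAt ((isOpen_extChartAt_target x₀).mem_nhds hu)
  have h2 := (contMDiffAt_frameForm α x₀ hx).comp u h1
  refine (contMDiffAt_iff_contDiffAt.1 h2).congr_of_eventuallyEq ?_
  filter_upwards [(isOpen_extChartAt_target x₀).mem_nhds hu] with w hw
  exact localForm_eq α x₀ hw

/-- The exterior derivative in the chart at `x₀`. -/
def localD (α : OneForm M) (x₀ : M) (u : E3) : E3 [⋀^Fin 2]→L[ℝ] ℝ :=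
  extDeriv (fun u => ContinuousAlternatingMap.ofSubsingleton ℝ E3 ℝ (0 : Fin 1)
      (localForm α x₀ u)) u

theorem contDiffAt_localD (α : OneForm M) (x₀ : M) {u : E3}
    (hu : u ∈ (extChartAt (𝓡 3) x₀).target) : ContDiffAt ℝ ∞ (localD α x₀) u := by
  have h1 : ContDiffAt ℝ ∞ (fun u => ContinuousAlternatingMap.ofSubsingleton ℝ E3 ℝ (0 : Fin 1)
      (localForm α x₀ u)) u :=
    (ContinuousAlternatingMap.ofSubsingletonLIE (𝕜 := ℝ) (E := E3) (F := ℝ) (0 : Fin 1)).contDiff.contDiffAt.comp u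
      (contDiffAt_localForm α x₀ hu)
  exact (ContinuousAlternatingMap.alternatizeUncurryFinCLM ℝ E3 ℝ).contDiff.contDiffAt.comp u
    (h1.fderiv_right (m := ∞) le_rfl)

/-- This is the cocycle identity of the tangent bundle, composed through the preferred chart at `y`;
the resulting coordinate change is the derivative of the transition map. -/
theorem chartDeriv_comp_frame {x₀ x y : M} (h₀ : y ∈ (chartAt E3 x₀).source)
    (h : y ∈ (chartAt E3 x).source) (v : E3) :
    chartDeriv x₀ y (frame x y v) =
      fderiv ℝ (extChartAt (𝓡 3) x₀ ∘ (extChartAt (𝓡 3) x).symm) (extChartAt (𝓡 3) x y) v := by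
  rw [chartDeriv_eq h₀, TangentBundle.continuousLinearMapAt_trivializationAt_eq_core h₀, frame,
    TangentBundle.symmL_trivializationAt_eq_core h]
  have h1 := (tangentBundleCore (𝓡 3) M).coordChange_comp (achart E3 x) (achart E3 y)
    (achart E3 x₀) y ⟨⟨h, mem_chart_source E3 y⟩, h₀⟩ v
  have h2 := tangentBundleCore_coordChange_achart (I := 𝓡 3) x x₀ y
  rw [ModelWithCorners.range_eq_univ, fderivWithin_univ] at h2
  rw [h2] at h1
  exact h1

/-- The exterior derivative may be computed in any chart. -/
theorem dForm_eq (α : OneForm M) {x₀ x : M} (hx : x ∈ (chartAt E3 x₀).source) :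
    dForm α x = (localD α x₀ (extChartAt (𝓡 3) x₀ x)).toAlternatingMap.compLinearMap
      (chartDeriv x₀ x).toLinearMap := by
  have hxx := mem_chart_source E3 x
  set φ := extChartAt (𝓡 3) x₀ with hφ
  set ψ := extChartAt (𝓡 3) x with hψ
  set pb : E3 → E3 [⋀^Fin 1]→L[ℝ] ℝ := fun u => ContinuousAlternatingMap.ofSubsingleton ℝ E3 ℝ
    (0 : Fin 1) (localForm α x₀ u) with hpb
  have hxψ : ψ.symm (ψ x) = x := ψ.left_inv (mem_extChartAt_source x)
  have hxφ : x ∈ φ.source := by simpa [hφ] using hx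
  have hτ : ContDiffAt ℝ ∞ (φ ∘ ψ.symm) (ψ x) := by
    have h1 : ContMDiffAt 𝓘(ℝ, E3) (𝓡 3) ∞ ψ.symm (ψ x) :=
      (contMDiffOn_extChartAt_symm x).contMDiffAt
        ((isOpen_extChartAt_target x).mem_nhds (mem_extChartAt_target x))
    have h2 : ContMDiffAt (𝓡 3) 𝓘(ℝ, E3) ∞ φ (ψ.symm (ψ x)) := by
      rw [hxψ]
      exact contMDiffAt_extChartAt' hx
    exact contMDiffAt_iff_contDiffAt.1 (h2.comp _ h1)
  -- Near `ψ x`, the coordinate expression in the chart at `x` is the pullback of the one at `x₀` by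
  -- the transition map. It then remains to use that `d` commutes with pullback.
  have hev : (fun u => ContinuousAlternatingMap.ofSubsingleton ℝ E3 ℝ (0 : Fin 1)
      (localForm α x u)) =ᶠ[𝓝 (ψ x)] fun u => (pb ((φ ∘ ψ.symm) u)).compContinuousLinearMap
        (fderiv ℝ (φ ∘ ψ.symm) u) := by
    have hc : ContinuousAt ψ.symm (ψ x) := continuousAt_extChartAt_symm x
    have hU : φ.source ∈ 𝓝 (ψ.symm (ψ x)) := by
      rw [hxψ]
      exact (isOpen_extChartAt_source x₀).mem_nhds hxφ
    filter_upwards [(isOpen_extChartAt_target x).mem_nhds (mem_extChartAt_target x), hc hU]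
      with u hu hu'
    have hy : ψ.symm u ∈ (chartAt E3 x).source := by simpa [hψ] using ψ.map_target hu
    have hy' : ψ.symm u ∈ (chartAt E3 x₀).source := by simpa [hφ] using hu'
    ext v
    change localForm α x u (v 0) = localForm α x₀ (φ (ψ.symm u)) (fderiv ℝ (φ ∘ ψ.symm) u (v 0))
    rw [localForm_eq α x hu, localForm_eq α x₀ (φ.map_source hu'), φ.left_inv hu']
    have h3 := chartDeriv_comp_frame hy' hy (v 0)
    rw [ψ.right_inv hu] at h3
    rw [← h3]
    simp only [frameForm, ContinuousLinearMap.comp_apply]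
    rw [frame_chartDeriv hy']
  have hD : DifferentiableAt ℝ pb ((φ ∘ ψ.symm) (ψ x)) := by
    have h1 : ContDiffAt ℝ ∞ pb ((φ ∘ ψ.symm) (ψ x)) := by
      refine (ContinuousAlternatingMap.ofSubsingletonLIE (𝕜 := ℝ) (E := E3) (F := ℝ) (0 : Fin 1)).contDiff.contDiffAt.comp
        _ (contDiffAt_localForm α x₀ ?_)
      rw [Function.comp_apply, hxψ]
      exact φ.map_source hxφ
    exact h1.differentiableAt (by simp)
  have key := extDeriv_pullback hD hτ (by
    rw [minSmoothness_of_isRCLikeNormedField]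
    exact ENat.LEInfty.out)
  rw [← hev.extDeriv_eq] at key
  rw [dForm, key]
  ext v
  change extDeriv pb ((φ ∘ ψ.symm) (ψ x)) _ = extDeriv pb (φ x) _
  rw [Function.comp_apply, hxψ]
  congr 1
  ext1 i
  change fderiv ℝ (φ ∘ ψ.symm) (ψ x) (chartDeriv x x (v i)) = chartDeriv x₀ x (v i)
  rw [← chartDeriv_comp_frame hx hxx, frame_chartDeriv hxx]

end Charts

section ContactForms

variable {M : Type*} [TopologicalSpace M] [ChartedSpace E3 M] [IsManifold (𝓡 3) ∞ M]

instance (x : M) : FiniteDimensional ℝ (TangentSpace (𝓡 3) x) :=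
  inferInstanceAs (FiniteDimensional ℝ E3)

instance (x : M) : T2Space (TangentSpace (𝓡 3) x) := inferInstanceAs (T2Space E3)

/-- The two-form `dα` as a continuous bilinear form. -/
def dBilin (α : OneForm M) (x : M) :
    TangentSpace (𝓡 3) x →L[ℝ] TangentSpace (𝓡 3) x →L[ℝ] ℝ :=
  LinearMap.toContinuousLinearMap
    (LinearMap.toContinuousLinearMap.toLinearMap ∘ₗ alternatingBilin (dForm α x))

@[simp]
theorem dBilin_apply (α : OneForm M) (x : M) (v w : TangentSpace (𝓡 3) x) :
    dBilin α x v w = dForm α x ![v, w] := rfl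

theorem dForm_frame (α : OneForm M) {x₀ x : M} (hx : x ∈ (chartAt E3 x₀).source) (v w : E3) :
    dForm α x ![frame x₀ x v, frame x₀ x w] = localD α x₀ (extChartAt (𝓡 3) x₀ x) ![v, w] := by
  rw [dForm_eq α hx]
  have h : (fun i => chartDeriv x₀ x (![frame x₀ x v, frame x₀ x w] i)) = ![v, w] := by
    ext1 i
    fin_cases i
    · exact chartDeriv_frame hx v
    · exact chartDeriv_frame hx w
  rw [← h]
  rfl

/-- The definition of `dForm` changes chart from point to point; `dForm_frame` computes it near `x`
in the single chart at `x`, where its coefficients are smooth. -/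
theorem contMDiffAt_dBilin (α : OneForm M) (x : M) :
    ContMDiffAt (𝓡 3) ((𝓡 3).prod 𝓘(ℝ, E3 →L[ℝ] E3 →L[ℝ] ℝ)) ∞
      (fun y => TotalSpace.mk' (E3 →L[ℝ] E3 →L[ℝ] ℝ)
        (E := fun x : M => TangentSpace (𝓡 3) x →L[ℝ] TangentSpace (𝓡 3) x →L[ℝ] ℝ)
        y (dBilin α y)) x := by
  refine contMDiffAt_bilin_of_frame fun v w => ?_
  have h1 : ContMDiffAt (𝓡 3) 𝓘(ℝ, E3 [⋀^Fin 2]→L[ℝ] ℝ) ∞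
      (fun y => localD α x (extChartAt (𝓡 3) x y)) x :=
    (contDiffAt_localD α x (mem_extChartAt_target x)).contMDiffAt.comp x contMDiffAt_extChartAt
  have h2 := (ContinuousAlternatingMap.apply ℝ E3 ℝ ![v, w]).contMDiff.contMDiffAt.comp x h1
  refine h2.congr_of_eventuallyEq ?_
  filter_upwards [(chartAt E3 x).open_source.mem_nhds (mem_chart_source E3 x)] with y hy
  rw [dBilin_apply, dForm_frame α hy]
  rfl

/-! ### The volume form `α ∧ dα` and the orientation that it induces. -/

/-- The coordinate vector fields of the preferred chart at `x₀`. -/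
def frameVec (x₀ x : M) (i : Fin 3) : TangentSpace (𝓡 3) x :=
  frame x₀ x (EuclideanSpace.basisFun (Fin 3) ℝ i)

theorem contMDiffAt_wedgeD_frameVec (α : OneForm M) {x₀ x : M}
    (hx : x ∈ (chartAt E3 x₀).source) :
    ContMDiffAt (𝓡 3) 𝓘(ℝ) ∞ (fun y => wedgeD α y (frameVec x₀ y)) x := by
  have h1 (i : Fin 3) := contMDiffAt_frame x₀ hx (EuclideanSpace.basisFun (Fin 3) ℝ i)
  have ha (i : Fin 3) := contMDiffAt_oneForm_apply α (h1 i)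
  have hβ (i j : Fin 3) := contMDiffAt_bilin_apply (contMDiffAt_dBilin α x) (h1 i) (h1 j)
  refine ContMDiffAt.congr_of_eventuallyEq
    ((((ha 0).mul (hβ 1 2)).sub ((ha 1).mul (hβ 0 2))).add ((ha 2).mul (hβ 0 1)))
    (Filter.Eventually.of_forall fun y => ?_)
  exact wedge_apply _ _ _

theorem compLinearMap_frame_chartDeriv {x₀ x : M} (hx : x ∈ (chartAt E3 x₀).source)
    (η : TangentSpace (𝓡 3) x [⋀^Fin 3]→ₗ[ℝ] ℝ) :
    (η.compLinearMap (frame x₀ x).toLinearMap).compLinearMap (chartDeriv x₀ x).toLinearMap = η := by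
  ext v
  change η (fun i => frame x₀ x (chartDeriv x₀ x (v i))) = η v
  simp_rw [frame_chartDeriv hx]

theorem compLinearMap_frame_eq {x₀ x : M} (η : TangentSpace (𝓡 3) x [⋀^Fin 3]→ₗ[ℝ] ℝ) :
    η.compLinearMap (frame x₀ x).toLinearMap =
      η (frameVec x₀ x) • (EuclideanSpace.basisFun (Fin 3) ℝ).toBasis.det := by
  rw [AlternatingMap.eq_smul_basis_det (EuclideanSpace.basisFun (Fin 3) ℝ).toBasis
    (η.compLinearMap (frame x₀ x).toLinearMap)]
  congr 1

theorem eq_smul_compLinearMap_chartDeriv {x₀ x : M} (hx : x ∈ (chartAt E3 x₀).source)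
    (η : TangentSpace (𝓡 3) x [⋀^Fin 3]→ₗ[ℝ] ℝ) :
    η = η (frameVec x₀ x) • (EuclideanSpace.basisFun (Fin 3) ℝ).toBasis.det.compLinearMap
      (chartDeriv x₀ x).toLinearMap := by
  conv_lhs => rw [← compLinearMap_frame_chartDeriv hx η, compLinearMap_frame_eq]
  rfl

theorem apply_frameVec_ne_zero {x₀ x : M} (hx : x ∈ (chartAt E3 x₀).source)
    {η : TangentSpace (𝓡 3) x [⋀^Fin 3]→ₗ[ℝ] ℝ} (hη : η ≠ 0) : η (frameVec x₀ x) ≠ 0 := by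
  intro h
  apply hη
  rw [eq_smul_compLinearMap_chartDeriv hx η, h, zero_smul]

/-- The orientation for which `α ∧ dα` is positive. -/
def inducedOrientation (α : OneForm M) (hα : IsContactForm α) : ManifoldOrientation M where
  at' x := rayOfNeZero ℝ _ (hα x)
  coherent x₀ := by
    have h₀ := mem_chart_source E3 x₀
    have hne := apply_frameVec_ne_zero h₀ (hα x₀)
    set c := wedgeD α x₀ (frameVec x₀ x₀) with hc
    have hcont : ContinuousAt (fun y => c * wedgeD α y (frameVec x₀ y)) x₀ :=
      continuousAt_const.mul (contMDiffAt_wedgeD_frameVec α h₀).continuousAt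
    have hpos : ∀ᶠ y in 𝓝 x₀, 0 < c * wedgeD α y (frameVec x₀ y) :=
      hcont.eventually (lt_mem_nhds (mul_self_pos.2 hne))
    -- The factor `c` supplies the sign of `α ∧ dα` at `x₀` relative to the chart; by continuity
    -- this sign persists nearby.
    refine ⟨c • (EuclideanSpace.basisFun (Fin 3) ℝ).toBasis.det, ?_⟩
    filter_upwards [hpos, (chartAt E3 x₀).open_source.mem_nhds h₀] with y hy hys
    have key := eq_smul_compLinearMap_chartDeriv hys (wedgeD α y)
    set δ := (EuclideanSpace.basisFun (Fin 3) ℝ).toBasis.det.compLinearMap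
      (chartDeriv x₀ y).toLinearMap with hδ
    have hδ0 : δ ≠ 0 := by
      intro h
      apply hα y
      rw [key, h, smul_zero]
    refine ⟨smul_ne_zero hne hδ0, ?_⟩
    refine (ray_eq_iff _ _).2 ?_
    have h3 : wedgeD α y = (wedgeD α y (frameVec x₀ y) / c) • (c • δ) := by
      conv_lhs => rw [key]
      rw [smul_smul, div_mul_cancel₀ _ hne]
    have h4 : 0 < wedgeD α y (frameVec x₀ y) / c := by
      have : wedgeD α y (frameVec x₀ y) / c = (c * wedgeD α y (frameVec x₀ y)) / (c * c) := by
        field_simp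
      rw [this]
      exact div_pos hy (mul_self_pos.2 hne)
    have h5 : SameRay ℝ ((wedgeD α y (frameVec x₀ y) / c) • (c • δ)) (c • δ) :=
      SameRay.sameRay_pos_smul_left _ h4
    rw [← h3] at h5
    exact h5

theorem isInducedOrientation_inducedOrientation (α : OneForm M) (hα : IsContactForm α) :
    IsInducedOrientation (inducedOrientation α hα) α :=
  fun x => ⟨hα x, rfl⟩

/-- Equality of rays becomes a sign, which later allows `√(w²) = w` for the value `w` of `α ∧ dα` on
an oriented basis. -/
theorem wedgeD_adjustToOrientation_pos {α : OneForm M} {o : ManifoldOrientation M}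
    (ho : IsInducedOrientation o α) (x : M) :
    0 < wedgeD α x ((coordBasis x).adjustToOrientation (o.at' x)) := by
  obtain ⟨h, hx⟩ := ho x
  set b := (coordBasis x).adjustToOrientation (o.at' x) with hb
  have h1 : b.orientation = rayOfNeZero ℝ _ h := by
    rw [hb, Module.Basis.orientation_adjustToOrientation, hx]
  rw [Module.Basis.orientation, ray_eq_iff] at h1
  obtain ⟨r, s, hr, hs, hrs⟩ := h1.exists_pos b.det_ne_zero h
  have h2 := congrArg (fun η : TangentSpace (𝓡 3) x [⋀^Fin 3]→ₗ[ℝ] ℝ => η b) hrs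
  simp only [AlternatingMap.smul_apply, smul_eq_mul, Module.Basis.det_self, mul_one] at h2
  exact (mul_pos_iff_of_pos_left hs).1 (h2 ▸ hr)

/-! ### Constructing metrics, and stretching them along and across the contact planes. -/

/-- The scalar product of a metric at a point as a bilinear map. -/
def metricForm (g : Metric3 M) (x : M) :
    TangentSpace (𝓡 3) x →ₗ[ℝ] TangentSpace (𝓡 3) x →ₗ[ℝ] ℝ :=
  ContinuousLinearMap.coeLM ℝ ∘ₗ (g.inner x).toLinearMap

@[simp]
theorem metricForm_apply (g : Metric3 M) (x : M) (v w : TangentSpace (𝓡 3) x) :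
    metricForm g x v w = g.inner x v w := rfl

/-- A positive definite continuous bilinear form on `ℝ³` has bounded unit balls. -/
theorem isVonNBounded_of_pos (B : E3 →L[ℝ] E3 →L[ℝ] ℝ) (hB : ∀ v, v ≠ 0 → 0 < B v v) :
    Bornology.IsVonNBounded ℝ {v : E3 | B v v < 1} := by
  have hcont : Continuous fun v => B v v := by fun_prop
  obtain ⟨u, hu, hmin⟩ := (isCompact_sphere (0 : E3) 1).exists_isMinOn
    (NormedSpace.sphere_nonempty.2 zero_le_one) hcont.continuousOn
  have hu0 : u ≠ 0 := by
    rintro rfl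
    simp at hu
  have hc := hB u hu0
  rw [NormedSpace.isVonNBounded_iff, isBounded_iff_forall_norm_le]
  -- By homogeneity `B v v ≥ B u u * ‖v‖²`, as `u` minimizes the quadratic form on the unit sphere.
  refine ⟨√((B u u)⁻¹), fun v hv => ?_⟩
  rcases eq_or_ne v 0 with rfl | hv0
  · simp
  have hn : 0 < ‖v‖ := norm_pos_iff.2 hv0
  have h1 : B u u ≤ B (‖v‖⁻¹ • v) (‖v‖⁻¹ • v) := by
    refine hmin ?_
    rw [mem_sphere_zero_iff_norm, norm_smul, norm_inv, norm_norm, inv_mul_cancel₀ hn.ne']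
  have h2 : B (‖v‖⁻¹ • v) (‖v‖⁻¹ • v) = (‖v‖ ^ 2)⁻¹ * B v v := by
    simp only [map_smul, smul_apply, smul_eq_mul]
    field_simp
  rw [h2, inv_mul_eq_div, le_div_iff₀ (by positivity)] at h1
  have h3 : B v v < 1 := hv
  refine Real.le_sqrt_of_sq_le ?_
  rw [inv_eq_one_div, le_div_iff₀ hc]
  linarith

/-- A smooth positive definite symmetric bilinear form is a Riemannian metric. -/
def metricOfBilin (B : ∀ x : M, TangentSpace (𝓡 3) x →L[ℝ] TangentSpace (𝓡 3) x →L[ℝ] ℝ)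
    (hs : ∀ x v w, B x v w = B x w v) (hp : ∀ x v, v ≠ 0 → 0 < B x v v)
    (hB : ∀ x, ContMDiffAt (𝓡 3) ((𝓡 3).prod 𝓘(ℝ, E3 →L[ℝ] E3 →L[ℝ] ℝ)) ∞
      (fun y => TotalSpace.mk' (E3 →L[ℝ] E3 →L[ℝ] ℝ)
        (E := fun x : M => TangentSpace (𝓡 3) x →L[ℝ] TangentSpace (𝓡 3) x →L[ℝ] ℝ) y (B y)) x) :
    Metric3 M where
  inner := B
  symm := hs
  pos := hp
  isVonNBounded x := isVonNBounded_of_pos (B x) (hp x)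
  contMDiff := hB

/-- The vector `R` is the unit normal of `ker a` for `B`. -/
def IsUnitDual {V : Type*} [AddCommGroup V] [Module ℝ V] (B : V → V → ℝ) (a : V → ℝ) (R : V) :
    Prop :=
  a R = 1 ∧ ∀ v, B R v = a v

/-- `p α⊗α + q (g - α⊗α)`, where `α` has unit length. -/
def stretch (α : OneForm M) (g : Metric3 M)
    (hg : ∀ x, ∃ R, IsUnitDual (fun v w => g.inner x v w) (α x) R)
    {p q : M → ℝ} (hp : ContMDiff (𝓡 3) 𝓘(ℝ) ∞ p) (hq : ContMDiff (𝓡 3) 𝓘(ℝ) ∞ q)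
    (hp0 : ∀ x, 0 < p x) (hq0 : ∀ x, 0 < q x) : Metric3 M :=
  metricOfBilin
    (fun x => p x • (α x).smulRight (α x) + q x • (g.inner x - (α x).smulRight (α x)))
    (fun x v w => by
      simp [g.symm x v w, mul_comm])
    (fun x v hv => by
      obtain ⟨R, haR, hR⟩ := hg x
      have h1 : 0 ≤ g.inner x v v - α x v * α x v := by
        -- The left side is the squared length of the component of `v` orthogonal to `R`, so `g -
        -- α⊗α` is positive semidefinite.
        have h2 : g.inner x (v - α x v • R) (v - α x v • R) = g.inner x v v - α x v * α x v := by
          have h3 : g.inner x v R = α x v := (g.symm x v R).trans (hR v)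
          simp only [map_sub, map_smul, sub_apply,
            smul_apply, smul_eq_mul, hR, h3, haR]
          ring
        rw [← h2]
        by_cases h0 : v - α x v • R = 0
        · simp [h0]
        · exact (g.pos x _ h0).le
      change 0 < p x * (α x v * α x v) + q x * (g.inner x v v - α x v * α x v)
      by_cases h0 : α x v = 0
      · rw [h0]
        simpa using mul_pos (hq0 x) (g.pos x v hv)
      · exact add_pos_of_pos_of_nonneg (mul_pos (hp0 x) (mul_self_pos.2 h0))
          (mul_nonneg (hq0 x).le h1))
    (fun x => contMDiffAt_bilin_of_frame fun v w => by
      have hv := contMDiffAt_frame x (mem_chart_source E3 x) v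
      have hw := contMDiffAt_frame x (mem_chart_source E3 x) w
      have hav := contMDiffAt_oneForm_apply α hv
      have haw := contMDiffAt_oneForm_apply α hw
      exact ((hp x).mul (hav.mul haw)).add
        ((hq x).mul ((contMDiffAt_bilin_apply (g.contMDiff x) hv hw).sub (hav.mul haw))))

theorem stretch_inner (α : OneForm M) (g : Metric3 M)
    (hg : ∀ x, ∃ R, IsUnitDual (fun v w => g.inner x v w) (α x) R)
    {p q : M → ℝ} (hp : ContMDiff (𝓡 3) 𝓘(ℝ) ∞ p) (hq : ContMDiff (𝓡 3) 𝓘(ℝ) ∞ q)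
    (hp0 : ∀ x, 0 < p x) (hq0 : ∀ x, 0 < q x) (x : M) (v w : TangentSpace (𝓡 3) x) :
    (stretch α g hg hp hq hp0 hq0).inner x v w =
      p x * (α x v * α x w) + q x * (g.inner x v w - α x v * α x w) := rfl

/-- `dα = c * α` for the metric `p α⊗α + q (g - α⊗α)`, provided its volume form is the right
multiple of `α ∧ dα`. -/
theorem dForm_eq_smul_hodge_stretch {α : OneForm M} {o : ManifoldOrientation M} {g : Metric3 M}
    (hg : ∀ x, ∃ R, IsUnitDual (fun v w => g.inner x v w) (α x) R)
    {p q : M → ℝ} (hp : ContMDiff (𝓡 3) 𝓘(ℝ) ∞ p) (hq : ContMDiff (𝓡 3) 𝓘(ℝ) ∞ q)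
    (hp0 : ∀ x, 0 < p x) (hq0 : ∀ x, 0 < q x) {x : M} {R : TangentSpace (𝓡 3) x}
    (hR : IsUnitDual (fun v w => g.inner x v w) (α x) R) (hdR : ∀ v, dForm α x ![R, v] = 0)
    {c : ℝ}
    (hvol : c * (√(p x) * q x * √(gram ((coordBasis x).adjustToOrientation (o.at' x))
      fun v w => g.inner x v w).det) =
        p x * wedgeD α x ((coordBasis x).adjustToOrientation (o.at' x))) :
    dForm α x = c • hodge o (stretch α g hg hp hq hp0 hq0) α x := by
  set b := (coordBasis x).adjustToOrientation (o.at' x)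
  refine eq_smul_hodgeIn (b := b) (B := metricForm (stretch α g hg hp hq hp0 hq0) x)
    ((stretch α g hg hp hq hp0 hq0).symm x) ((stretch α g hg hp hq hp0 hq0).pos x) (R := R)
    hR.1 hdR (hp0 x).ne' (fun v => ?_) ?_
  · have hRv : g.inner x R v = α x v := hR.2 v
    rw [metricForm_apply, stretch_inner, hR.1, hRv]
    simp
  · have h := gram_combine_det b (B := metricForm g x) (a := (α x).toLinearMap) (R := R) hR.2 hR.1
      (g.symm x) (p x) (q x)
    have h' : (gram b fun v w => metricForm (stretch α g hg hp hq hp0 hq0) x v w).det =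
        p x * q x ^ 2 * (gram b fun v w => g.inner x v w).det := h
    rw [h', Real.sqrt_mul (mul_nonneg (hp0 x).le (sq_nonneg _)), Real.sqrt_mul (hp0 x).le,
      Real.sqrt_sq (hq0 x).le]
    exact hvol

/-- The vector `α^♯` of an adapted metric is the Reeb vector of `α`. -/
theorem IsAdapted.sharp_spec {α : OneForm M} {o : ManifoldOrientation M} {g : Metric3 M}
    (h : IsAdapted o g α) (x : M) :
    IsUnitDual (fun v w => g.inner x v w) (α x) (sharp g α x) ∧
      (∀ v, dForm α x ![sharp g α x, v] = 0) ∧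
      2 * √(gram ((coordBasis x).adjustToOrientation (o.at' x)) fun v w => g.inner x v w).det =
        wedgeD α x ((coordBasis x).adjustToOrientation (o.at' x)) := by
  have h1 : ∀ v, g.inner x (sharp g α x) v = α x v :=
    apply_sharpIn (coordBasis x) (metricForm g x) (g.symm x) (g.pos x) (α x).toLinearMap
  have h2 : IsUnitDual (fun v w => g.inner x v w) (α x) (sharp g α x) :=
    ⟨(h1 _).symm.trans (h.2 x).2, h1⟩
  exact ⟨h2, reeb_of_eq_smul_hodgeIn (B := metricForm g x) (g.symm x) (g.pos x) h1 h2.1 (h.2 x).1⟩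

end ContactForms

/-! ### Existence of adapted metrics and solutions of the Beltrami equation. -/

section AdaptedMetrics

variable {M : Type*} [TopologicalSpace M] [ChartedSpace E3 M] [IsManifold (𝓡 3) ∞ M]

/-- The symmetric positive definite bilinear forms `B` for which the kernel of `dα` is
`B`-orthogonal to `ker α`, with `B(R, ·) = α` for the Reeb vector `R`. -/
def reebCompatible (α : OneForm M) (x : M) :
    Set (TangentSpace (𝓡 3) x →L[ℝ] TangentSpace (𝓡 3) x →L[ℝ] ℝ) :=
  {B | (∀ v w, B v w = B w v) ∧ (∀ v, v ≠ 0 → 0 < B v v) ∧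
    ∀ v, (∀ u, dForm α x ![v, u] = 0) → ∀ w, B v w = α x v * α x w}

/-- The last condition is affine in `B` and quantifies over `ker dα` rather than naming the Reeb
field, whose smoothness is thus never needed. -/
theorem convex_reebCompatible (α : OneForm M) (x : M) : Convex ℝ (reebCompatible α x) := by
  rintro B ⟨hs, hp, hk⟩ C ⟨hs', hp', hk'⟩ a b ha hb hab
  refine ⟨fun v w => ?_, fun v hv => ?_, fun v hv w => ?_⟩
  · change a * B v w + b * C v w = a * B w v + b * C w v
    rw [hs, hs']
  · change 0 < a * B v v + b * C v v
    rcases ha.eq_or_lt with rfl | ha'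
    · rw [zero_add] at hab
      simpa [hab] using hp' v hv
    · exact add_pos_of_pos_of_nonneg (mul_pos ha' (hp v hv)) (mul_nonneg hb (hp' v hv).le)
  · change a * B v w + b * C v w = α x v * α x w
    rw [hk v hv, hk' v hv, ← add_mul, hab, one_mul]

/-- The bilinear form `α⊗α + ∑ᵢ dα(·, eᵢ)⊗dα(·, eᵢ)` for the coordinate frame `eᵢ` at `x₀`. -/
def localReebMetric (α : OneForm M) (x₀ x : M) :
    TangentSpace (𝓡 3) x →L[ℝ] TangentSpace (𝓡 3) x →L[ℝ] ℝ :=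
  (α x).smulRight (α x) + ∑ i, (dBilin α x (frameVec x₀ x i)).smulRight
    (dBilin α x (frameVec x₀ x i))

theorem localReebMetric_apply (α : OneForm M) (x₀ x : M) (v w : TangentSpace (𝓡 3) x) :
    localReebMetric α x₀ x v w = α x v * α x w +
      ∑ i, dForm α x ![frameVec x₀ x i, v] * dForm α x ![frameVec x₀ x i, w] := by
  simp [localReebMetric]

/-- A sum of squares vanishing at `v` puts `v` in `ker α ∩ ker dα`, which is zero for a contact
form. On `ker dα` only the term `α⊗α` survives. -/
theorem localReebMetric_mem {α : OneForm M} (hα : IsContactForm α) {x₀ x : M}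
    (hx : x ∈ (chartAt E3 x₀).source) : localReebMetric α x₀ x ∈ reebCompatible α x := by
  refine ⟨fun v w => ?_, fun v hv => ?_, fun v hv w => ?_⟩
  · simp only [localReebMetric_apply, mul_comm]
  · rw [localReebMetric_apply]
    have h1 : 0 ≤ ∑ i, dForm α x ![frameVec x₀ x i, v] * dForm α x ![frameVec x₀ x i, v] :=
      Finset.sum_nonneg fun i _ => mul_self_nonneg _
    refine lt_of_le_of_ne (add_nonneg (mul_self_nonneg _) h1) fun h0 => hv ?_
    have h2 : α x v * α x v = 0 := by linarith [mul_self_nonneg (α x v)]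
    have h3 : ∑ i, dForm α x ![frameVec x₀ x i, v] * dForm α x ![frameVec x₀ x i, v] = 0 := by
      linarith
    have hav : α x v = 0 := mul_self_eq_zero.1 h2
    have hβ (i : Fin 3) : dForm α x ![frameVec x₀ x i, v] = 0 :=
      mul_self_eq_zero.1 ((Finset.sum_eq_zero_iff_of_nonneg fun i _ => mul_self_nonneg _).1 h3 i
        (Finset.mem_univ i))
    have hβv : ∀ w, dForm α x ![w, v] = 0 := by
      intro w
      rw [← frame_chartDeriv hx w,
        ← (EuclideanSpace.basisFun (Fin 3) ℝ).sum_repr (chartDeriv x₀ x w), map_sum,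
        ← dBilin_apply, map_sum]
      simp only [map_smul, sum_apply, smul_apply, dBilin_apply]
      refine Finset.sum_eq_zero fun i _ => ?_
      have := hβ i
      rw [frameVec] at this
      rw [this, smul_zero]
    exact eq_zero_of_wedge_ne_zero (coordBasis x) (hα x) hav fun w => by
      rw [map_pair_swap, hβv, neg_zero]
  · rw [localReebMetric_apply]
    have h (u : TangentSpace (𝓡 3) x) : dForm α x ![u, v] = 0 := by
      rw [map_pair_swap, hv, neg_zero]
    simp [h]

theorem contMDiffAt_localReebMetric (α : OneForm M) {x₀ x : M}
    (hx : x ∈ (chartAt E3 x₀).source) :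
    ContMDiffAt (𝓡 3) ((𝓡 3).prod 𝓘(ℝ, E3 →L[ℝ] E3 →L[ℝ] ℝ)) ∞
      (fun y => TotalSpace.mk' (E3 →L[ℝ] E3 →L[ℝ] ℝ)
        (E := fun x : M => TangentSpace (𝓡 3) x →L[ℝ] TangentSpace (𝓡 3) x →L[ℝ] ℝ)
        y (localReebMetric α x₀ y)) x := by
  refine contMDiffAt_bilin_of_frame fun v w => ?_
  have hv := contMDiffAt_frame x (mem_chart_source E3 x) v
  have hw := contMDiffAt_frame x (mem_chart_source E3 x) w
  have he (i : Fin 3) := contMDiffAt_frame x₀ hx (EuclideanSpace.basisFun (Fin 3) ℝ i)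
  have hβ := contMDiffAt_dBilin α x
  simp only [localReebMetric_apply]
  exact ((contMDiffAt_oneForm_apply α hv).mul (contMDiffAt_oneForm_apply α hw)).add
    (ContMDiffAt.sum fun i _ => (contMDiffAt_bilin_apply hβ (he i) hv).mul
      (contMDiffAt_bilin_apply hβ (he i) hw))

set_option synthInstance.maxHeartbeats 200000 in
set_option maxHeartbeats 1000000 in
/-- A contact form has a metric for which the Reeb field is the unit normal of the contact
planes. -/
theorem exists_reeb_metric [T2Space M] [SecondCountableTopology M] {α : OneForm M}
    (hα : IsContactForm α) : ∃ g : Metric3 M, ∀ x, ∃ R,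
      IsUnitDual (fun v w => g.inner x v w) (α x) R ∧ ∀ v, dForm α x ![R, v] = 0 := by
  have : LocallyCompactSpace M := ChartedSpace.locallyCompactSpace E3 M
  have hex := exists_contMDiffSection_forall_mem_convex_of_local (𝓡 3) (n := ⊤)
    (F_fiber := E3 →L[ℝ] E3 →L[ℝ] ℝ)
    (fun x : M => TangentSpace (𝓡 3) x →L[ℝ] TangentSpace (𝓡 3) x →L[ℝ] ℝ)
    (reebCompatible α)
  obtain ⟨s, hs⟩ := hex (convex_reebCompatible α)
    (fun x₀ => ⟨(chartAt E3 x₀).source,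
      (chartAt E3 x₀).open_source.mem_nhds (mem_chart_source E3 x₀), localReebMetric α x₀,
      fun x hx => (contMDiffAt_localReebMetric α hx).contMDiffWithinAt,
      fun x hx => localReebMetric_mem hα hx⟩)
  refine ⟨metricOfBilin s (fun x => (hs x).1) (fun x => (hs x).2.1) s.contMDiff, fun x => ?_⟩
  obtain ⟨R, haR, hR⟩ := exists_reeb_of_wedge_ne_zero (coordBasis x) (hα x)
  refine ⟨R, ⟨haR, fun v => ?_⟩, hR⟩
  have h := (hs x).2.2 R hR v
  have haR' : α x R = 1 := haR
  rw [haR', one_mul] at h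
  exact h

/-- Half the ratio of `|α ∧ dα|` to the Riemannian volume form. -/
def volumeRatio (α : OneForm M) (g : Metric3 M) (x : M) : ℝ :=
  √(wedgeD α x (coordBasis x) ^ 2 / (4 * (gram (coordBasis x) fun v w => g.inner x v w).det))

/-- Numerator and denominator both scale by the squared determinant of the change of basis. -/
theorem volumeRatio_eq (α : OneForm M) (g : Metric3 M) {x : M}
    {v : Fin 3 → TangentSpace (𝓡 3) x} (hv : (coordBasis x).det v ≠ 0) :
    volumeRatio α g x = √(wedgeD α x v ^ 2 /
      (4 * (Matrix.of fun i j => g.inner x (v i) (v j)).det)) := by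
  have h1 := gram_family_det (B := metricForm g x) (coordBasis x) v
  simp only [metricForm_apply] at h1
  rw [h1, alternating_family_apply (coordBasis x) (wedgeD α x) v, volumeRatio]
  congr 1
  rw [mul_pow, mul_left_comm, mul_div_mul_left _ _ (pow_ne_zero 2 hv)]

theorem volumeRatio_pos {α : OneForm M} (hα : IsContactForm α) (g : Metric3 M) (x : M) :
    0 < volumeRatio α g x := by
  have h1 : wedgeD α x (coordBasis x) ≠ 0 := fun h => hα x <| by
    rw [AlternatingMap.eq_smul_basis_det (coordBasis x) (wedgeD α x), h, zero_smul]
  have h2 := gram_det_pos (coordBasis x) (metricForm g x) (g.symm x) (g.pos x)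
  simp only [metricForm_apply] at h2
  exact Real.sqrt_pos.2 (div_pos (by positivity) (by positivity))

/-- `coordBasis x` may jump with the preferred chart, so the ratio is computed in the frame of one
fixed chart; its radicand is positive, where the square root is smooth. -/
theorem contMDiff_volumeRatio {α : OneForm M} (hα : IsContactForm α) (g : Metric3 M) :
    ContMDiff (𝓡 3) 𝓘(ℝ) ∞ (volumeRatio α g) := by
  intro x₀
  have h₀ := mem_chart_source E3 x₀
  have hdet {x : M} (hx : x ∈ (chartAt E3 x₀).source) :
      (coordBasis x).det (frameVec x₀ x) ≠ 0 := fun h =>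
    apply_frameVec_ne_zero hx (hα x) (by rw [alternating_family_apply (coordBasis x), h, zero_mul])
  have he (i : Fin 3) := contMDiffAt_frame x₀ h₀ (EuclideanSpace.basisFun (Fin 3) ℝ i)
  have hg (i j : Fin 3) := contMDiffAt_bilin_apply (g.contMDiff x₀) (he i) (he j)
  have hG : ContMDiffAt (𝓡 3) 𝓘(ℝ) ∞ (fun x => 4 *
      (Matrix.of fun i j => g.inner x (frameVec x₀ x i) (frameVec x₀ x j)).det) x₀ := by
    simp only [Matrix.det_fin_three, Matrix.of_apply]
    have t (i j k l m n : Fin 3) := ((hg i j).mul (hg k l)).mul (hg m n)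
    exact contMDiffAt_const.mul ((((((t 0 0 1 1 2 2).sub (t 0 0 1 2 2 1)).sub
      (t 0 1 1 0 2 2)).add (t 0 1 1 2 2 0)).add (t 0 2 1 0 2 1)).sub (t 0 2 1 1 2 0))
  have hW := (contMDiffAt_wedgeD_frameVec α h₀).pow 2
  have hpos := volumeRatio_pos hα g x₀
  rw [volumeRatio_eq α g (hdet h₀), Real.sqrt_pos] at hpos
  have hG0 : 4 * (Matrix.of fun i j => g.inner x₀ (frameVec x₀ x₀ i) (frameVec x₀ x₀ j)).det ≠ 0 :=
    fun h => by simp [h] at hpos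
  have hsqrt := (Real.contDiffAt_sqrt (n := ∞) hpos.ne').contMDiffAt.comp x₀
    (hW.div₀ hG hG0)
  refine hsqrt.congr_of_eventuallyEq ?_
  filter_upwards [(chartAt E3 x₀).open_source.mem_nhds h₀] with x hx
  exact volumeRatio_eq α g (hdet hx)

/-- Taking `p = 1` keeps `R` unit and dual to `α`; then `q` must satisfy `2 q √|g| = α ∧ dα` on an
oriented basis, which is what `volumeRatio` solves. -/
theorem exists_isAdapted [T2Space M] [SecondCountableTopology M] {α : OneForm M}
    (hα : IsContactForm α) {o : ManifoldOrientation M} (ho : IsInducedOrientation o α) :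
    ∃ g : Metric3 M, IsAdapted o g α := by
  obtain ⟨g, hg⟩ := exists_reeb_metric hα
  have hg' : ∀ x, ∃ R, IsUnitDual (fun v w => g.inner x v w) (α x) R :=
    fun x => (hg x).imp fun R h => h.1
  set g' := stretch α g hg' contMDiff_const (contMDiff_volumeRatio hα g) (fun _ => zero_lt_one)
    (volumeRatio_pos hα g) with hg'def
  refine ⟨g', hα, fun x => ?_⟩
  obtain ⟨R, hR, hdR⟩ := hg x
  constructor
  · refine dForm_eq_smul_hodge_stretch hg' _ _ _ _ hR hdR ?_
    set b := (coordBasis x).adjustToOrientation (o.at' x)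
    have h1 : (coordBasis x).det b ≠ 0 := ((coordBasis x).isUnit_det b).ne_zero
    have h2 := volumeRatio_eq α g h1
    have h3 : 0 < wedgeD α x b := wedgeD_adjustToOrientation_pos ho x
    have h4 : 0 < (gram b fun v w => g.inner x v w).det :=
      gram_det_pos b (metricForm g x) (g.symm x) (g.pos x)
    have h5 : (Matrix.of fun i j => g.inner x (b i) (b j)) = gram b fun v w => g.inner x v w := rfl
    rw [h5, Real.sqrt_div (sq_nonneg _), Real.sqrt_sq h3.le, Real.sqrt_mul (by norm_num),
      show √(4 : ℝ) = 2 by rw [show (4 : ℝ) = 2 ^ 2 by norm_num]; exact Real.sqrt_sq zero_le_two]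
      at h2
    have h6 := (Real.sqrt_pos.2 h4).ne'
    rw [h2, Real.sqrt_one]
    field_simp
  · have hR' : ∀ v, g'.inner x R v = α x v := fun v => by
      have hRv : g.inner x R v = α x v := hR.2 v
      rw [hg'def, stretch_inner, hR.1, hRv]
      ring
    have h : sharp g' α x = R :=
      sharpIn_eq (coordBasis x) (metricForm g' x) (g'.symm x) (g'.pos x)
        (a := (α x).toLinearMap) hR'
    rw [h, hR', hR.1]

/-- Stretching an adapted metric by `p` along the Reeb field and by `q` along the contact planes
solves `dα = f * α` when `f q = 2 √p`. -/
theorem IsAdapted.beltramiEq_stretch {α : OneForm M} {o : ManifoldOrientation M} {g : Metric3 M}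
    (h : IsAdapted o g α) {p q : M → ℝ} (hp : ContMDiff (𝓡 3) 𝓘(ℝ) ∞ p)
    (hq : ContMDiff (𝓡 3) 𝓘(ℝ) ∞ q) (hp0 : ∀ x, 0 < p x) (hq0 : ∀ x, 0 < q x)
    {f : C^∞⟮𝓡 3, M; ℝ⟯} (hf : ∀ x, f x * q x = 2 * √(p x)) :
    BeltramiEq o (stretch α g (fun x => ⟨_, (h.sharp_spec x).1⟩) hp hq hp0 hq0) f α := by
  intro x
  obtain ⟨hR, hdR, hvol⟩ := h.sharp_spec x
  refine dForm_eq_smul_hodge_stretch _ _ _ _ _ hR hdR ?_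
  rw [← hvol]
  have h1 := Real.mul_self_sqrt (hp0 x).le
  set S := √(gram ((coordBasis x).adjustToOrientation (o.at' x)) fun v w => g.inner x v w).det
  -- The relation `f q = 2 √p` is multiplied by `√p S`, and `√p * √p` is replaced by `p`.
  linear_combination √(p x) * S * hf x + 2 * S * h1

theorem isContactForm_of_isRotationalBeltrami {α : OneForm M} {o : ManifoldOrientation M}
    {g : Metric3 M} (h : IsRotationalBeltrami o g α) (h0 : ∀ x, α x ≠ 0) : IsContactForm α := by
  obtain ⟨f, hf, hfα⟩ := h
  intro x
  have ha : (α x).toLinearMap ≠ 0 := fun h1 => h0 x (ContinuousLinearMap.ext fun v =>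
    LinearMap.congr_fun h1 v)
  exact wedge_ne_zero_of_eq_smul_hodgeIn (B := metricForm g x) (g.symm x) (g.pos x) ha (hf x)
    (hfα x)

end AdaptedMetrics

end BeltramiContact

end

/-! ### The main theorem. -/

theorem proposition2 {M : Type*} [TopologicalSpace M] [T2Space M] [SecondCountableTopology M]
    [ChartedSpace E3 M] [IsManifold (𝓡 3) ∞ M] (α : OneForm M) :
    (∀ (o : ManifoldOrientation M) (g : Metric3 M),
      IsRotationalBeltrami o g α → (∀ x, α x ≠ 0) → IsContactForm α) ∧
    (IsContactForm α →
      ∃ o : ManifoldOrientation M, IsInducedOrientation o α ∧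
        (∃ g : Metric3 M, IsAdapted o g α) ∧
        ∀ f : C^∞⟮𝓡 3, M; ℝ⟯, (∀ x, 0 < f x) →
          (∀ g : Metric3 M, IsAdapted o g α → ∃ g' : Metric3 M,
            IsRescaling (fun x => 4 / f x ^ 2) g g' ∧
            BeltramiEq o g' f α ∧ IsRotationalBeltrami o g' α) ∧
          (Nonempty M → ∃ g₁ g₂ : Metric3 M, g₁ ≠ g₂ ∧
            BeltramiEq o g₁ f α ∧ BeltramiEq o g₂ f α)) := by
  refine ⟨fun o g => isContactForm_of_isRotationalBeltrami, fun hα => ?_⟩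
  have ho := isInducedOrientation_inducedOrientation α hα
  refine ⟨inducedOrientation α hα, ho, exists_isAdapted hα ho, fun f hf => ?_⟩
  have hsmooth (c : ℝ) : ContMDiff (𝓡 3) 𝓘(ℝ) ∞ fun x => c / f x ^ 2 :=
    contMDiff_const.div₀ (f.contMDiff.pow 2) fun x => (pow_pos (hf x) 2).ne'
  have hpos {c : ℝ} (hc : 0 < c) (x : M) : 0 < c / f x ^ 2 := div_pos hc (pow_pos (hf x) 2)
  have hsqrt {c d : ℝ} (hc : 0 < c) (hd : d = c ^ 2) (x : M) : √(d / f x ^ 2) = c / f x := by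
    rw [hd, ← div_pow, Real.sqrt_sq (div_pos hc (hf x)).le]
  have h4 : (0 : ℝ) < 4 := by norm_num
  have h4f (x : M) : f x * (4 / f x ^ 2) = 2 * √(4 / f x ^ 2) := by
    have := (hf x).ne'
    rw [hsqrt two_pos (by norm_num)]
    field_simp
    norm_num
  -- A second solution of `f q = 2 √p`, with `p = 16 / f²` and `q = 8 / f²`.
  have h8f (x : M) : f x * (8 / f x ^ 2) = 2 * √(16 / f x ^ 2) := by
    have := (hf x).ne'
    rw [hsqrt h4 (by norm_num)]
    field_simp
    norm_num
  constructor
  · intro g hg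
    have hB := hg.beltramiEq_stretch (hsmooth 4) (hsmooth 4) (hpos h4) (hpos h4) h4f
    refine ⟨_, fun x v w => ?_, hB, f, fun x => (hf x).ne', hB⟩
    -- For `p = q` the terms in `α⊗α` cancel, leaving a conformal rescaling.
    rw [stretch_inner]
    ring
  · rintro ⟨x⟩
    obtain ⟨g₀, hg⟩ := exists_isAdapted hα ho
    refine ⟨_, _, fun heq => ?_,
      hg.beltramiEq_stretch (hsmooth 4) (hsmooth 4) (hpos h4) (hpos h4) h4f,
      hg.beltramiEq_stretch (hsmooth 16) (hsmooth 8) (hpos (by norm_num)) (hpos (by norm_num)) h8f⟩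
    -- The Reeb vector separates the two metrics: its squared lengths are `4 / f²` and `16 / f²`.
    obtain ⟨⟨haR, hR⟩, -⟩ := hg.sharp_spec x
    have hRR : g₀.inner x (sharp g₀ α x) (sharp g₀ α x) = 1 := (hR _).trans haR
    have h := congrArg (fun g : Metric3 M => g.inner x (sharp g₀ α x) (sharp g₀ α x)) heq
    simp only [stretch_inner, haR, hRR] at h
    have := (hf x).ne'
    field_simp at h
    norm_num at h
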